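/- Let $n\ge 1$ be an integer and let $\nu>-1$ be real with $\nu\neq 0$. Let $$p(z)=F(-n,\nu+2;-n-\nu+1;z)=\sum_{k=0}^n \frac{(-n)_k(\nu+2)_k}{(-n-\nu+1)_k}\frac{z^k}{k!},$$ where $(a)_0=1$ and $(a)_k=a(a+1)\cdots(a+k-1)$ for $k\ge 1$; let $q$ be its conjugate-reciprocal polynomial, $q(z)=z^n\overline{p(1/\bar z)}$, and let $B=p/q$, denoted $B(-n,\nu+2;-n-\nu+1;z)$. Write $\mathbb T=\{z\in\mathbb C:|z|=1\}$. Then $B$ is a hypergeometric Blaschke product of degree $n$: the denominators $(-n-\nu+1)_k$, $0\le k\le n$, do not vanish, all zeros of $p$ lie in the open unit disk, and $B(z)=\alpha\prod_{k=1}^n\frac{z-a_k}{1-\overline{a_k}z}$ for some $|\alpha|=1$ and $|a_k|<1$. With $M(B)=\sup_{|z|=1}|B'(z)|$ and $m(B)=\inf_{|z|=1}|B'(z)|$, it has the following properties: $$M(B)=n+\nu,\quad m(B)=\frac{n}{\nu+1}\qquad\text{if }\nu>0,$$ $$M(B)=\frac{n}{\nu+1},\quad m(B)=n+\nu\qquad\text{if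 }-1<\nu<0.$$ Both extremes are attained within the set $\mathcal E=\{z\in\mathbb T: zB(z)=1\}$, that is, $|B'|=M(B)$ at some point of $\mathcal E$ and $|B'|=m(B)$ at some point of $\mathcal E$. Specifically, $|B'(z)|=n+\nu$ for every $z\in\mathcal E\setminus\{1\}$, while $1\in\mathcal E$ and $|B'(1)|=n/(\nu+1)$. -/

import Mathlib

noncomputable section

/-- `B` is a finite Blaschke product of degree `n`: a unimodular constant times a product of `n`
Möbius factors `(z - a) / (1 - conj a * z)` with `a` in the open unit disk. (With `x / 0 = 0`,
both sides are compared also at the poles, where the right-hand side is `0`.) -/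
def IsBlaschkeProduct (n : ℕ) (B : ℂ → ℂ) : Prop :=
  ∃ (α : ℂ) (a : Fin n → ℂ), ‖α‖ = 1 ∧ (∀ k, ‖a k‖ < 1) ∧
    ∀ z, B z = α * ∏ k, (z - a k) / (1 - starRingEnd ℂ (a k) * z)

/-- `M(B)`, the supremum of `|B'|` over the unit circle. -/
def maxDeriv (B : ℂ → ℂ) : ℝ :=
  sSup ((fun z => ‖deriv B z‖) '' Metric.sphere (0 : ℂ) 1)

/-- `m(B)`, the infimum of `|B'|` over the unit circle. -/
def minDeriv (B : ℂ → ℂ) : ℝ :=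
  sInf ((fun z => ‖deriv B z‖) '' Metric.sphere (0 : ℂ) 1)

/-- The hypergeometric polynomial `F(-n, b; c; z)`, whose `k`-th coefficient is
`(-n)_k (b)_k / ((c)_k k!)`. -/
def hyperPoly (n : ℕ) (b c : ℂ) : Polynomial ℂ :=
  ∑ k ∈ Finset.range (n + 1),
    Polynomial.monomial k (ordinaryHypergeometricCoefficient (-(n : ℂ)) b c k)

/-- The polynomial `hyperPoly n b c` is the (terminating) Gauss hypergeometric series. -/
theorem eval_hyperPoly (n : ℕ) (b c z : ℂ) :
    (hyperPoly n b c).eval z = ₂F₁ (-(n : ℂ)) b c z := by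
  rw [ordinaryHypergeometric_eq_tsum, hyperPoly, Polynomial.eval_finsetSum]
  beta_reduce
  rw [tsum_eq_sum (s := Finset.range (n + 1))]
  · refine Finset.sum_congr rfl fun k _ => ?_
    simp [ordinaryHypergeometricCoefficient, Polynomial.eval_monomial]
  · intro k hk
    have hk' : n < k := by simpa [Nat.lt_succ_iff] using hk
    have h0 : (ascPochhammer ℂ k).eval (-(n : ℂ)) = 0 :=
      (ascPochhammer_eval_eq_zero_iff k _).2 ⟨n, hk', by simp⟩
    simp [h0]

/-- The conjugate-reciprocal polynomial `q(z) = z ^ n * conj (p (1 / conj z))` of a polynomial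
`p` of degree at most `n`. -/
def conjReciprocal (n : ℕ) (p : Polynomial ℂ) : Polynomial ℂ :=
  (p.map (starRingEnd ℂ)).reflect n

theorem eval_conjReciprocal (n : ℕ) (p : Polynomial ℂ) (hp : p.natDegree ≤ n) {z : ℂ}
    (hz : z ≠ 0) :
    (conjReciprocal n p).eval z
      = z ^ n * starRingEnd ℂ (p.eval (1 / starRingEnd ℂ z)) := by
  have hd : (p.map (starRingEnd ℂ)).natDegree ≤ n :=
    (Polynomial.natDegree_map_le).trans hp
  have hi : Invertible z⁻¹ := invertibleOfNonzero (inv_ne_zero hz)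
  have h := Polynomial.eval₂_reflect_mul_pow (RingHom.id ℂ) z⁻¹ n _ hd
  rw [invOf_eq_inv, inv_inv, Polynomial.eval₂_id, Polynomial.eval₂_id] at h
  have h2 : starRingEnd ℂ (p.eval (1 / starRingEnd ℂ z))
      = (p.map (starRingEnd ℂ)).eval z⁻¹ := by
    have := Polynomial.eval_map_apply (p := p) (f := starRingEnd ℂ) (x := 1 / starRingEnd ℂ z)
    rw [← this]
    simp
  rw [h2, ← h, conjReciprocal, mul_left_comm, ← mul_pow, mul_inv_cancel₀ hz, one_pow, mul_one]

/-- The quotient `B(-n, b; c; z) = p(z) / q(z)`, where `p(z) = F(-n, b; c; z)` and `q` is the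
conjugate-reciprocal polynomial of `p`. -/
def hyperBlaschke (n : ℕ) (b c : ℂ) (z : ℂ) : ℂ :=
  (hyperPoly n b c).eval z / (conjReciprocal n (hyperPoly n b c)).eval z

/-- `B(-n, b; c; z)` is a hypergeometric Blaschke product: the parameter `c` is admissible, all
zeros of the hypergeometric polynomial lie in the open unit disk, and the quotient is a Blaschke
product of degree `n`. -/
structure IsHyperBlaschke (n : ℕ) (b c : ℂ) : Prop where
  admissible : ∀ k < n, c ≠ -(k : ℂ)
  zeros : ∀ z, (hyperPoly n b c).eval z = 0 → ‖z‖ < 1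
  blaschke : IsBlaschkeProduct n (hyperBlaschke n b c)

/-- The set of points `z` of the unit circle with `z * B z = 1`. -/
def extremeSet (B : ℂ → ℂ) : Set ℂ :=
  {z | z ∈ Metric.sphere (0 : ℂ) 1 ∧ z * B z = 1}

end

/-!
Put `l = ν + 1`. Up to a common constant, `p` and `q` are the Lagrange polynomials `g_n^(l+1,l-1)`
and `g_n^(l-1,l+1)`; let `g = g_n^(l,l)`. Two polynomial identities carry the proof:
`l (z p - q) = (n + l) (z - 1) g`, and an expression of the Wronskian of `q` and `p` as a
combination of `p q` and `g ^ 2`. On the unit circle `p q = z ^ n |p| ^ 2` and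
`g ^ 2 = z ^ n |g| ^ 2`, so the second identity reads
`z B'(z) / B(z) = (1 - t) (n + ν) + t n / (ν + 1)` with `t = |g| ^ 2 / |p| ^ 2`.

Moreover `t ≤ 1`: the polynomial `n (p q - g ^ 2)` is `-(1 - z) ^ 2` times another Wronskian, which
is a positive multiple of `z ^ (n - 1)` on the circle by a recursion of Christoffel–Darboux type.
By the first identity, `z B(z) = 1` holds exactly at `z = 1`, where `t = 1`, and at the zeros of
`g`, where `t = 0`. All zeros of `g` lie on the circle and all zeros of `p` inside it, because
`z g_(n-1)^(l+1,l)` is smaller than `g_(n-1)^(l,l+1)` in modulus inside the circle and larger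
outside.
-/

open Polynomial Finset

section BinomialRing

variable {R : Type*} [CommRing R] [BinomialRing R]

theorem factorial_mul_multichoose (r : R) (k : ℕ) :
    (k.factorial : R) * Ring.multichoose r k = (ascPochhammer R k).eval r := by
  rw [← nsmul_eq_mul, Ring.factorial_nsmul_multichoose_eq_ascPochhammer,
    Polynomial.ascPochhammer_smeval_eq_eval]

theorem succ_mul_multichoose_succ (r : R) (k : ℕ) :
    ((k : R) + 1) * Ring.multichoose r (k + 1) = r * Ring.multichoose (r + 1) k := by
  have := BinomialRing.toIsAddTorsionFree (R := R)
  refine nsmul_right_injective k.factorial_ne_zero ?_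
  simp only [nsmul_eq_mul]
  calc (k.factorial : R) * ((k + 1) * Ring.multichoose r (k + 1))
      = ((k + 1).factorial : R) * Ring.multichoose r (k + 1) := by
        rw [Nat.factorial_succ]; push_cast; ring
    _ = r * (ascPochhammer R k).eval (r + 1) := by
        rw [factorial_mul_multichoose, ascPochhammer_succ_left, eval_mul, eval_comp]
        simp only [eval_X, eval_add, eval_one]
    _ = (k.factorial : R) * (r * Ring.multichoose (r + 1) k) := by
        rw [← factorial_mul_multichoose]; ring

theorem multichoose_add (r s : R) (n : ℕ) :
    Ring.multichoose (r + s) n =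
      ∑ ij ∈ antidiagonal n, Ring.multichoose r ij.1 * Ring.multichoose s ij.2 := by
  have h (t : R) (k : ℕ) : Ring.multichoose t k = (-1) ^ k * Ring.choose (-t) k := by
    rw [Ring.choose_neg, Units.smul_def, zsmul_eq_mul, Int.coe_negOnePow_natCast, Int.cast_pow,
      Int.cast_neg, Int.cast_one, ← mul_assoc, ← mul_pow, neg_one_mul, neg_neg, one_pow, one_mul,
      Ring.multichoose_eq]
  rw [h, neg_add, Ring.add_choose_eq n (Commute.all _ _), mul_sum]
  refine sum_congr rfl fun ij hij => ?_
  rw [h, h, ← mem_antidiagonal.1 hij, pow_add]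
  ring

/-- The Lagrange polynomial `g_n^(a,b)(z, 1)`, that is, the coefficient of `t ^ n` in
`(1 - z t) ^ (-a) * (1 - t) ^ (-b)`. Up to constants, `F(-n, a; 1 - b - n; z)` is of this form, and
unlike it depends polynomially on `b`. -/
noncomputable def lagrangePoly (a b : R) (n : ℕ) : R[X] :=
  ∑ ij ∈ antidiagonal n, monomial ij.1 (Ring.multichoose a ij.1 * Ring.multichoose b ij.2)

theorem coeff_lagrangePoly (a b : R) (n k : ℕ) :
    (lagrangePoly a b n).coeff k =
      if k ≤ n then Ring.multichoose a k * Ring.multichoose b (n - k) else 0 := by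
  simp only [lagrangePoly, finsetSum_coeff, coeff_monomial,
    Nat.sum_antidiagonal_eq_sum_range_succ_mk, sum_ite_eq', mem_range, Nat.lt_succ_iff]

theorem natDegree_lagrangePoly_le (a b : R) (n : ℕ) : (lagrangePoly a b n).natDegree ≤ n :=
  natDegree_le_iff_coeff_eq_zero.2 fun k hk => by rw [coeff_lagrangePoly, if_neg (by omega)]

theorem natDegree_lagrangePoly {a b : R} {n : ℕ} (ha : Ring.multichoose a n ≠ 0) :
    (lagrangePoly a b n).natDegree = n := by
  refine natDegree_eq_of_le_of_coeff_ne_zero (natDegree_lagrangePoly_le a b n) ?_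
  rwa [coeff_lagrangePoly, if_pos le_rfl, Nat.sub_self, Ring.multichoose_zero_right, mul_one]

@[simp]
theorem lagrangePoly_zero (a b : R) : lagrangePoly a b 0 = 1 := by
  simp [lagrangePoly]

theorem eval_one_lagrangePoly (a b : R) (n : ℕ) :
    (lagrangePoly a b n).eval 1 = Ring.multichoose (a + b) n := by
  simp only [lagrangePoly, eval_finsetSum, eval_monomial, one_pow, mul_one, multichoose_add]

theorem lagrangePoly_add_one_left (a b : R) (n : ℕ) :
    lagrangePoly (a + 1) b (n + 1) = X * lagrangePoly (a + 1) b n + lagrangePoly a b (n + 1) := by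
  simp only [lagrangePoly, Nat.sum_antidiagonal_succ, Ring.multichoose_succ_succ,
    Ring.multichoose_zero_right, mul_sum, X_mul_monomial, add_mul, map_add, sum_add_distrib]
  ring

theorem lagrangePoly_add_one_right (a b : R) (n : ℕ) :
    lagrangePoly a (b + 1) (n + 1) = lagrangePoly a (b + 1) n + lagrangePoly a b (n + 1) := by
  simp only [lagrangePoly, Nat.sum_antidiagonal_succ', Ring.multichoose_succ_succ,
    Ring.multichoose_zero_right, mul_add, map_add, sum_add_distrib]
  ring

theorem one_sub_X_mul_lagrangePoly (a b : R) (n : ℕ) :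
    (1 - X) * lagrangePoly (a + 1) (b + 1) n =
      lagrangePoly a (b + 1) (n + 1) - lagrangePoly (a + 1) b (n + 1) := by
  linear_combination lagrangePoly_add_one_left a (b + 1) n - lagrangePoly_add_one_right (a + 1) b n

theorem derivative_lagrangePoly_succ (a b : R) (n : ℕ) :
    derivative (lagrangePoly a b (n + 1)) = C a * lagrangePoly (a + 1) b n := by
  rw [lagrangePoly, Nat.sum_antidiagonal_succ, derivative_add, derivative_sum, lagrangePoly,
    mul_sum, monomial_zero_left, derivative_C, zero_add]
  refine sum_congr rfl fun ij _ => ?_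
  rw [derivative_monomial, C_mul_monomial, Nat.add_sub_cancel]
  congr 1
  push_cast
  linear_combination Ring.multichoose b ij.2 * succ_mul_multichoose_succ a ij.1

theorem succ_mul_lagrangePoly_succ (a b : R) (n : ℕ) :
    ((n : R[X]) + 1) * lagrangePoly a b (n + 1) =
      C a * (X * lagrangePoly (a + 1) b n) + C b * lagrangePoly a (b + 1) n := by
  let term (ij : ℕ × ℕ) : R := Ring.multichoose a ij.1 * Ring.multichoose b ij.2
  calc ((n : R[X]) + 1) * lagrangePoly a b (n + 1)
      = ∑ ij ∈ antidiagonal (n + 1), monomial ij.1 ((ij.1 : R) * term ij) +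
          ∑ ij ∈ antidiagonal (n + 1), monomial ij.1 ((ij.2 : R) * term ij) := by
        rw [lagrangePoly, mul_sum, ← sum_add_distrib]
        refine sum_congr rfl fun ij hij => ?_
        rw [← map_add, ← add_mul, ← Nat.cast_add, mem_antidiagonal.1 hij,
          ← C_mul_monomial (a := ((n + 1 : ℕ) : R)), map_natCast, Nat.cast_succ]
    _ = C a * (X * lagrangePoly (a + 1) b n) + C b * lagrangePoly a (b + 1) n := by
        rw [Nat.sum_antidiagonal_succ, Nat.sum_antidiagonal_succ']
        simp only [lagrangePoly, mul_sum, X_mul_monomial, C_mul_monomial, Nat.cast_zero, zero_mul,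
          map_zero, zero_add, term, Nat.cast_add, Nat.cast_one]
        congr 1 <;> refine sum_congr rfl fun ij _ => congrArg _ ?_
        · linear_combination Ring.multichoose b ij.2 * succ_mul_multichoose_succ a ij.1
        · linear_combination Ring.multichoose a ij.1 * succ_mul_multichoose_succ b ij.2

theorem one_sub_X_mul_derivative_lagrangePoly_left (a b : R) (n : ℕ) :
    (1 - X) * (X * derivative (lagrangePoly (a + 1) b n)) =
      (n : R[X]) * (1 - X) * lagrangePoly (a + 1) b n -
        C b * (lagrangePoly a (b + 1) n - lagrangePoly (a + 1) b n) := by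
  cases n with
  | zero => simp
  | succ n =>
    rw [derivative_lagrangePoly_succ]
    push_cast
    linear_combination (X - 1) * succ_mul_lagrangePoly_succ (a + 1) b n -
      C b * one_sub_X_mul_lagrangePoly a b n

theorem one_sub_X_mul_derivative_lagrangePoly_right (a b : R) (n : ℕ) :
    (1 - X) * derivative (lagrangePoly a (b + 1) n) =
      C a * (lagrangePoly a (b + 1) n - lagrangePoly (a + 1) b n) := by
  cases n with
  | zero => simp
  | succ n =>
    rw [derivative_lagrangePoly_succ]
    linear_combination C a * one_sub_X_mul_lagrangePoly a b n

theorem lagrangePoly_add_one_sub_one (l : R) (n : ℕ) :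
    lagrangePoly (l + 1) (l - 1) (n + 1) =
      lagrangePoly l l (n + 1) - (1 - X) * lagrangePoly (l + 1) l n := by
  have h := one_sub_X_mul_lagrangePoly l (l - 1) n
  rw [sub_add_cancel] at h
  linear_combination h

theorem lagrangePoly_sub_one_add_one (l : R) (n : ℕ) :
    lagrangePoly (l - 1) (l + 1) (n + 1) =
      lagrangePoly l l (n + 1) + (1 - X) * lagrangePoly l (l + 1) n := by
  have h := one_sub_X_mul_lagrangePoly (l - 1) l n
  rw [sub_add_cancel] at h
  linear_combination -h

theorem C_mul_X_mul_lagrangePoly_sub (l : R) (n : ℕ) :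
    C l * (X * lagrangePoly (l + 1) (l - 1) n - lagrangePoly (l - 1) (l + 1) n) =
      (C l + (n : R[X])) * ((X - 1) * lagrangePoly l l n) := by
  cases n with
  | zero => simp
  | succ n =>
    rw [lagrangePoly_add_one_sub_one, lagrangePoly_sub_one_add_one]
    push_cast
    linear_combination (1 - X) * succ_mul_lagrangePoly_succ l l n

theorem wronskian_lagrangePoly_shift_two (l : R) (n : ℕ) :
    C l * (X * wronskian (lagrangePoly (l - 1) (l + 1) n) (lagrangePoly (l + 1) (l - 1) n)) =
      C l * (C l + (n : R[X]) - 1) *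
          (lagrangePoly (l + 1) (l - 1) n * lagrangePoly (l - 1) (l + 1) n) +
        (C l + (n : R[X])) * (1 - C l) * lagrangePoly l l n ^ 2 := by
  refine (monic_X_sub_C (1 : R)).isRegular.left ?_
  have hP := one_sub_X_mul_derivative_lagrangePoly_left l (l - 1) n
  have hQ := one_sub_X_mul_derivative_lagrangePoly_right (l - 1) l n
  rw [sub_add_cancel] at hP hQ
  simp only [wronskian, C_sub, C_1] at hP hQ ⊢
  linear_combination C l * X * lagrangePoly (l + 1) (l - 1) n * hQ -
    C l * lagrangePoly (l - 1) (l + 1) n * hP -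
    (C l - 1) * lagrangePoly l l n * C_mul_X_mul_lagrangePoly_sub l n

theorem succ_mul_mul_lagrangePoly_sub_sq (l : R) (n : ℕ) :
    ((n : R[X]) + 1) * (lagrangePoly (l + 1) (l - 1) (n + 1) * lagrangePoly (l - 1) (l + 1) (n + 1)
        - lagrangePoly l l (n + 1) ^ 2) =
      -((1 - X) ^ 2 * wronskian (lagrangePoly l (l + 1) n) (X * lagrangePoly (l + 1) l n)) := by
  have hS := one_sub_X_mul_derivative_lagrangePoly_left l l n
  have hV := one_sub_X_mul_derivative_lagrangePoly_right l l n
  have hG := succ_mul_lagrangePoly_succ l l n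
  rw [lagrangePoly_add_one_sub_one, lagrangePoly_sub_one_add_one]
  simp only [wronskian, derivative_mul, derivative_X, one_mul]
  linear_combination (1 - X) * (lagrangePoly l (l + 1) n) * hS -
    (1 - X) * X * (lagrangePoly (l + 1) l n) * hV +
    (1 - X) * (lagrangePoly l (l + 1) n - lagrangePoly (l + 1) l n) * hG

theorem succ_mul_wronskian_lagrangePoly_succ (l : R) (n : ℕ) :
    ((n : R[X]) + 1) *
        wronskian (lagrangePoly l (l + 1) (n + 1)) (X * lagrangePoly (l + 1) l (n + 1)) =
      ((n : R[X]) + 1) * (lagrangePoly (l + 1) l (n + 1) * lagrangePoly l (l + 1) (n + 1)) +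
        ((n : R[X]) + 1 + 2 * C l) *
          (X * wronskian (lagrangePoly l (l + 1) n) (X * lagrangePoly (l + 1) l n)) := by
  have hG := succ_mul_lagrangePoly_succ l l n
  have hG' := congrArg derivative hG
  rw [lagrangePoly_add_one_left, lagrangePoly_add_one_right]
  simp only [wronskian, derivative_mul, derivative_add, derivative_X, derivative_C,
    derivative_natCast, derivative_one, zero_mul, zero_add, one_mul, add_zero] at hG' ⊢
  linear_combination
    X * (lagrangePoly (l + 1) l n + X * derivative (lagrangePoly (l + 1) l n) -
      derivative (lagrangePoly l (l + 1) n)) * hG +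
    X * (lagrangePoly l (l + 1) n - X * lagrangePoly (l + 1) l n) * hG'

end BinomialRing

theorem multichoose_eq_zero_iff {K : Type*} [Field K] [CharZero K] {r : K} {n : ℕ} :
    Ring.multichoose r n = 0 ↔ ∃ i < n, (i : K) = -r := by
  rw [← ascPochhammer_eval_eq_zero_iff, ← factorial_mul_multichoose, mul_eq_zero_iff_left]
  exact Nat.cast_ne_zero.2 n.factorial_ne_zero

theorem multichoose_ofReal_ne_zero {x : ℝ} (hx : -1 < x) (hx0 : x ≠ 0) (n : ℕ) :
    Ring.multichoose (x : ℂ) n ≠ 0 := by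
  rw [Ne, multichoose_eq_zero_iff]
  rintro ⟨i, -, hi⟩
  have hi : (i : ℝ) = -x := by exact_mod_cast hi
  obtain rfl : i = 0 := by
    have : (i : ℝ) < 1 := by linarith
    exact Nat.lt_one_iff.1 (by exact_mod_cast this)
  exact hx0 (by simpa using hi.symm)

theorem ascPochhammer_eval_reverse {R : Type*} [CommRing R] (x : R) (k j : ℕ) :
    (ascPochhammer R k).eval (-((k + j : ℕ) : R) - x + 1) * (ascPochhammer R j).eval x =
      (-1) ^ k * (ascPochhammer R (k + j)).eval x := by
  induction k generalizing j with
  | zero => simp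
  | succ k ih =>
    have h := ih (j + 1)
    rw [← add_assoc, add_right_comm] at h
    rw [ascPochhammer_succ_eval] at h ⊢
    push_cast at h ⊢
    linear_combination -h

theorem coeff_hyperPoly (n : ℕ) (b c : ℂ) (k : ℕ) :
    (hyperPoly n b c).coeff k =
      if k ≤ n then ordinaryHypergeometricCoefficient (-(n : ℂ)) b c k else 0 := by
  simp only [hyperPoly, finsetSum_coeff, coeff_monomial, sum_ite_eq', mem_range, Nat.lt_succ_iff]

theorem lagrangePoly_eq_C_mul_hyperPoly {a b : ℂ} {n : ℕ} (hb : Ring.multichoose b n ≠ 0) :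
    lagrangePoly a b n = C (Ring.multichoose b n) * hyperPoly n a (-(n : ℂ) - b + 1) := by
  ext k
  rw [coeff_C_mul, coeff_hyperPoly, coeff_lagrangePoly]
  split_ifs with h
  swap
  · rw [mul_zero]
  obtain ⟨j, rfl⟩ := Nat.exists_eq_add_of_le h
  have hfact (i : ℕ) : (i.factorial : ℂ) ≠ 0 := Nat.cast_ne_zero.2 i.factorial_ne_zero
  have hmultichoose (r : ℂ) (i : ℕ) :
      Ring.multichoose r i = (ascPochhammer ℂ i).eval r / i.factorial :=
    eq_div_of_mul_eq (hfact i) (by rw [mul_comm, factorial_mul_multichoose])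
  have hnum := ascPochhammer_eval_reverse (1 : ℂ) k j
  rw [sub_add_cancel, ascPochhammer_eval_one, ascPochhammer_eval_one] at hnum
  have hden := ascPochhammer_eval_reverse b k j
  have hden0 : (ascPochhammer ℂ k).eval (-((k + j : ℕ) : ℂ) - b + 1) ≠ 0 := by
    refine left_ne_zero_of_mul (b := (ascPochhammer ℂ j).eval b) ?_
    rw [hden, ← factorial_mul_multichoose]
    exact mul_ne_zero (pow_ne_zero k (neg_ne_zero.2 one_ne_zero)) (mul_ne_zero (hfact _) hb)
  rw [ordinaryHypergeometricCoefficient, Nat.add_sub_cancel_left, hmultichoose, hmultichoose,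
    hmultichoose]
  field_simp [hfact]
  linear_combination (ascPochhammer ℂ k).eval a *
    (((k + j).factorial : ℂ) * hden - (ascPochhammer ℂ (k + j)).eval b * hnum)

open scoped ComplexConjugate

theorem conjReciprocal_C_mul (n : ℕ) (c : ℂ) (p : ℂ[X]) :
    conjReciprocal n (C c * p) = C (conj c) * conjReciprocal n p := by
  rw [conjReciprocal, Polynomial.map_mul, map_C, reflect_C_mul, conjReciprocal]

theorem conjReciprocal_lagrangePoly (a b : ℂ) (n : ℕ) :
    conjReciprocal n (lagrangePoly a b n) = lagrangePoly (conj b) (conj a) n := by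
  ext k
  rw [conjReciprocal, coeff_reflect, coeff_map, coeff_lagrangePoly, coeff_lagrangePoly]
  split_ifs with h1 h2 h2
  · rw [revAt_le h2, map_mul, Ring.map_multichoose, Ring.map_multichoose, Nat.sub_sub_self h2,
      mul_comm]
  · rw [revAt_eq_self_of_lt (not_le.1 h2)] at h1
    exact absurd h1 h2
  · rw [revAt_le h2] at h1
    exact absurd (Nat.sub_le n k) h1
  · exact map_zero _

theorem eval_mul_eval_conjReciprocal {n : ℕ} {p : ℂ[X]} (hp : p.natDegree ≤ n) {z : ℂ}
    (hz : ‖z‖ = 1) :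
    p.eval z * (conjReciprocal n p).eval z = z ^ n * (‖p.eval z‖ ^ 2 : ℝ) := by
  have hz0 : z ≠ 0 := norm_ne_zero_iff.1 (hz ▸ one_ne_zero)
  have hconj : 1 / conj z = z := by
    rw [← Complex.inv_eq_conj hz, one_div, inv_inv]
  rw [eval_conjReciprocal n p hp hz0, hconj, mul_left_comm, Complex.mul_conj']
  push_cast
  rfl

theorem eval_lagrangePoly_mul_eval_lagrangePoly_conj (a b : ℂ) (n : ℕ) {z : ℂ} (hz : ‖z‖ = 1) :
    (lagrangePoly a b n).eval z * (lagrangePoly (conj b) (conj a) n).eval z =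
      z ^ n * (‖(lagrangePoly a b n).eval z‖ ^ 2 : ℝ) := by
  rw [← conjReciprocal_lagrangePoly,
    eval_mul_eval_conjReciprocal (natDegree_lagrangePoly_le a b n) hz]

theorem one_sub_sq_of_norm_eq_one {z : ℂ} (hz : ‖z‖ = 1) :
    (1 - z) ^ 2 = -(z * (‖1 - z‖ ^ 2 : ℝ)) := by
  have hz' : z * conj z = 1 := by rw [Complex.mul_conj', hz, Complex.ofReal_one, one_pow]
  rw [Complex.ofReal_pow, ← Complex.mul_conj', map_sub, map_one]
  linear_combination (z - 1) * hz'

section Circle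

variable {l : ℝ} {n : ℕ} {z : ℂ}

theorem exists_pos_eval_wronskian_lagrangePoly (hl : 0 ≤ l) (hz : ‖z‖ = 1) :
    ∃ w : ℝ, 0 < w ∧
      (wronskian (lagrangePoly (l : ℂ) (l + 1) n) (X * lagrangePoly ((l : ℂ) + 1) l n)).eval z =
        z ^ n * w := by
  induction n with
  | zero => exact ⟨1, one_pos, by simp [wronskian]⟩
  | succ n ih =>
    obtain ⟨w, hw, hWw⟩ := ih
    refine ⟨‖(lagrangePoly ((l : ℂ) + 1) l (n + 1)).eval z‖ ^ 2 + (n + 1 + 2 * l) / (n + 1) * w,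
      by positivity, ?_⟩
    have hrec := congrArg (eval z) (succ_mul_wronskian_lagrangePoly_succ (l : ℂ) n)
    have hSV := eval_lagrangePoly_mul_eval_lagrangePoly_conj ((l : ℂ) + 1) l (n + 1) hz
    simp only [map_add, map_one, Complex.conj_ofReal] at hSV
    simp only [eval_mul, eval_add, eval_natCast, eval_one, eval_ofNat, eval_C, eval_X, hWw, hSV]
      at hrec
    have hn : (n : ℂ) + 1 ≠ 0 := Nat.cast_add_one_ne_zero n
    refine mul_left_cancel₀ hn (hrec.trans ?_)
    push_cast
    field_simp
    ring

theorem exists_pos_sq_norm_eval_lagrangePoly_sub (hl : 0 ≤ l) (hz : ‖z‖ = 1) :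
    ∃ w : ℝ, 0 < w ∧
      (n + 1) * (‖(lagrangePoly ((l : ℂ) + 1) (l - 1) (n + 1)).eval z‖ ^ 2 -
        ‖(lagrangePoly (l : ℂ) l (n + 1)).eval z‖ ^ 2) = ‖1 - z‖ ^ 2 * w := by
  obtain ⟨w, hw, hWw⟩ := exists_pos_eval_wronskian_lagrangePoly (n := n) hl hz
  refine ⟨w, hw, Complex.ofReal_injective (mul_left_cancel₀ (pow_ne_zero (n + 1)
    (norm_ne_zero_iff.1 (hz ▸ one_ne_zero) : z ≠ 0)) ?_)⟩
  have h := congrArg (eval z) (succ_mul_mul_lagrangePoly_sub_sq (l : ℂ) n)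
  have hPQ := eval_lagrangePoly_mul_eval_lagrangePoly_conj ((l : ℂ) + 1) (l - 1) (n + 1) hz
  have hg := eval_lagrangePoly_mul_eval_lagrangePoly_conj (l : ℂ) l (n + 1) hz
  simp only [map_add, map_sub, map_one, Complex.conj_ofReal] at hPQ hg
  simp only [eval_mul, eval_add, eval_sub, eval_neg, eval_pow, eval_natCast, eval_one, eval_X,
    hWw, hPQ, one_sub_sq_of_norm_eq_one hz] at h
  push_cast at h hg ⊢
  linear_combination h + (n + 1) * hg

theorem norm_eval_lagrangePoly_le (hl : 0 ≤ l) (hz : ‖z‖ = 1) :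
    ‖(lagrangePoly (l : ℂ) l n).eval z‖ ≤ ‖(lagrangePoly ((l : ℂ) + 1) (l - 1) n).eval z‖ := by
  cases n with
  | zero => simp
  | succ n =>
    obtain ⟨w, hw, h⟩ := exists_pos_sq_norm_eval_lagrangePoly_sub (n := n) hl hz
    refine le_of_sq_le_sq ?_ (norm_nonneg _)
    have : 0 ≤ ‖1 - z‖ ^ 2 * w := by positivity
    rw [← h] at this
    exact sub_nonneg.1 (nonneg_of_mul_nonneg_right this (by positivity))

theorem eval_lagrangePoly_ne_zero_of_norm_eq_one (hl : 0 < l) (hz : ‖z‖ = 1) :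
    (lagrangePoly ((l : ℂ) + 1) (l - 1) n).eval z ≠ 0 := by
  cases n with
  | zero => simp
  | succ n =>
    intro hP
    obtain ⟨w, hw, h⟩ := exists_pos_sq_norm_eval_lagrangePoly_sub (n := n) hl.le hz
    have hg : (lagrangePoly (l : ℂ) l (n + 1)).eval z = 0 :=
      norm_le_zero_iff.1 ((norm_eval_lagrangePoly_le hl.le hz).trans_eq (hP ▸ norm_zero))
    have hz1 : z = 1 := by
      rw [hP, hg, sub_self, mul_zero, eq_comm, mul_eq_zero_iff_right hw.ne', sq_eq_zero_iff,
        norm_eq_zero, sub_eq_zero] at h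
      exact h.symm
    rw [hz1, eval_one_lagrangePoly, ← Complex.ofReal_add] at hg
    exact multichoose_ofReal_ne_zero (by linarith) (by positivity) _ hg

end Circle

theorem norm_add_smul_add_lt {E : Type*} [NormedAddCommGroup E] [InnerProductSpace ℝ E]
    {u v : E} {c : ℝ} (hc : 0 ≤ c) (h : ‖u‖ < ‖v‖) :
    ‖u + c • (u + v)‖ < ‖v + c • (u + v)‖ := by
  have hsq : ‖v + c • (u + v)‖ ^ 2 - ‖u + c • (u + v)‖ ^ 2 =
      (1 + 2 * c) * (‖v‖ ^ 2 - ‖u‖ ^ 2) := by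
    simp only [norm_add_sq_real, norm_smul, inner_add_right, inner_smul_right, mul_pow,
      real_inner_self_eq_norm_sq, real_inner_comm u v]
    ring
  have hlt : ‖u‖ ^ 2 < ‖v‖ ^ 2 := by gcongr
  refine lt_of_pow_lt_pow_left₀ 2 (norm_nonneg _) (sub_pos.1 (hsq ▸ ?_))
  exact mul_pos (by positivity) (sub_pos.2 hlt)

section Roots

variable {l : ℝ} {n : ℕ} {z : ℂ}

theorem eval_lagrangePoly_succ_eq_smul (l : ℝ) (n : ℕ) (z : ℂ) :
    (lagrangePoly (l : ℂ) l (n + 1)).eval z =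
      (l / (n + 1)) • (z * (lagrangePoly ((l : ℂ) + 1) l n).eval z +
        (lagrangePoly (l : ℂ) (l + 1) n).eval z) := by
  have h := congrArg (eval z) (succ_mul_lagrangePoly_succ (l : ℂ) l n)
  simp only [eval_mul, eval_add, eval_natCast, eval_one, eval_C, eval_X] at h
  rw [Complex.real_smul]
  push_cast
  field_simp
  linear_combination h

theorem norm_mul_eval_lagrangePoly_lt (hl : 0 ≤ l) (hz : ‖z‖ < 1) :
    ‖z * (lagrangePoly ((l : ℂ) + 1) l n).eval z‖ < ‖(lagrangePoly (l : ℂ) (l + 1) n).eval z‖ := by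
  induction n with
  | zero => simpa using hz
  | succ n ih =>
    rw [lagrangePoly_add_one_left, lagrangePoly_add_one_right, eval_add, eval_add, eval_mul, eval_X,
      eval_lagrangePoly_succ_eq_smul, norm_mul]
    exact (mul_le_of_le_one_left (norm_nonneg _) hz.le).trans_lt
      (norm_add_smul_add_lt (by positivity) ih)

theorem norm_eval_lagrangePoly_lt_norm_mul (hl : 0 ≤ l) (hz : 1 < ‖z‖) :
    ‖(lagrangePoly (l : ℂ) (l + 1) n).eval z‖ < ‖z * (lagrangePoly ((l : ℂ) + 1) l n).eval z‖ := by
  induction n with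
  | zero => simpa using hz
  | succ n ih =>
    rw [lagrangePoly_add_one_left, lagrangePoly_add_one_right, eval_add, eval_add, eval_mul, eval_X,
      eval_lagrangePoly_succ_eq_smul, norm_mul, add_comm (z * _) (eval z _)]
    exact (norm_add_smul_add_lt (by positivity) ih).trans_le
      (le_mul_of_one_le_left (norm_nonneg _) hz.le)

theorem norm_lt_one_of_eval_lagrangePoly_eq_zero (hl : 0 < l)
    (hP : (lagrangePoly ((l : ℂ) + 1) (l - 1) n).eval z = 0) : ‖z‖ < 1 := by
  cases n with
  | zero => simp at hP
  | succ n =>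
    refine lt_of_le_of_ne (not_lt.1 fun hz => ?_)
      fun hz => eval_lagrangePoly_ne_zero_of_norm_eq_one hl hz hP
    have hg := congrArg (eval z) (succ_mul_lagrangePoly_succ (l : ℂ) l n)
    rw [lagrangePoly_add_one_sub_one] at hP
    simp only [eval_mul, eval_add, eval_sub, eval_natCast, eval_one, eval_C, eval_X] at hP hg
    set s := (lagrangePoly ((l : ℂ) + 1) l n).eval z
    set v := (lagrangePoly (l : ℂ) (l + 1) n).eval z
    have hs : (l : ℂ) * v = ((n + 1 : ℝ) - (n + 1 + l : ℝ) * z) * s := by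
      push_cast
      linear_combination (n + 1) * hP - hg
    have hcoef : l * ‖z‖ ≤ ‖((n + 1 : ℝ) - (n + 1 + l : ℝ) * z : ℂ)‖ :=
      calc l * ‖z‖ ≤ (n + 1 + l) * ‖z‖ - (n + 1) := by nlinarith
        _ = ‖((n + 1 + l : ℝ) * z : ℂ)‖ - ‖((n + 1 : ℝ) : ℂ)‖ := by
          rw [norm_mul, Complex.norm_of_nonneg (by positivity),
            Complex.norm_of_nonneg (by positivity)]
        _ ≤ _ := norm_sub_rev (_ : ℂ) _ ▸ norm_sub_norm_le _ _
    have : l * ‖z * s‖ ≤ l * ‖v‖ :=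
      calc l * ‖z * s‖ = l * ‖z‖ * ‖s‖ := by rw [norm_mul, mul_assoc]
        _ ≤ ‖((n + 1 : ℝ) - (n + 1 + l : ℝ) * z : ℂ)‖ * ‖s‖ := by gcongr
        _ = l * ‖v‖ := by rw [← norm_mul, ← hs, norm_mul, Complex.norm_of_nonneg hl.le]
    exact (le_of_mul_le_mul_left this hl).not_gt (norm_eval_lagrangePoly_lt_norm_mul hl.le hz)

theorem exists_norm_eq_one_eval_lagrangePoly_eq_zero (hl : 0 < l) (hn : 1 ≤ n) :
    ∃ z : ℂ, ‖z‖ = 1 ∧ z ≠ 1 ∧ (lagrangePoly (l : ℂ) l n).eval z = 0 := by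
  have hmc {x : ℝ} (hx : 0 < x) (k : ℕ) : Ring.multichoose (x : ℂ) k ≠ 0 :=
    multichoose_ofReal_ne_zero (by linarith) hx.ne' k
  have hdeg : 0 < (lagrangePoly (l : ℂ) l n).natDegree := by
    rwa [natDegree_lagrangePoly (hmc hl n)]
  obtain ⟨z, hz⟩ := IsAlgClosed.exists_root (lagrangePoly (l : ℂ) l n)
    (natDegree_pos_iff_degree_pos.1 hdeg).ne'
  refine ⟨z, ?_, ?_, hz⟩
  · obtain ⟨n, rfl⟩ := Nat.exists_eq_add_of_le' hn
    have hnorm : ‖z * (lagrangePoly ((l : ℂ) + 1) l n).eval z‖ =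
        ‖(lagrangePoly (l : ℂ) (l + 1) n).eval z‖ := by
      rw [IsRoot, eval_lagrangePoly_succ_eq_smul, smul_eq_zero_iff_right (by positivity),
        add_eq_zero_iff_eq_neg] at hz
      rw [hz, norm_neg]
    exact le_antisymm (not_lt.1 fun h => (norm_eval_lagrangePoly_lt_norm_mul hl.le h).ne' hnorm)
      (not_lt.1 fun h => (norm_mul_eval_lagrangePoly_lt hl.le h).ne hnorm)
  · rintro rfl
    rw [IsRoot, eval_one_lagrangePoly, ← Complex.ofReal_add] at hz
    exact hmc (add_pos hl hl) n hz

end Roots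

theorem exists_eq_C_leadingCoeff_mul_prod {K : Type*} [Field K] [IsAlgClosed K] {p : K[X]} {n : ℕ}
    (hn : p.natDegree = n) : ∃ a : Fin n → K, p = C p.leadingCoeff * ∏ k, (X - C (a k)) := by
  have hs := IsAlgClosed.splits p
  obtain ⟨L, hL⟩ : ∃ L : List K, (L : Multiset K) = p.roots := Quot.exists_rep p.roots
  obtain rfl : L.length = n := by
    rw [← hn, hs.natDegree_eq_card_roots, ← hL, Multiset.coe_card]
  refine ⟨fun k => L[k], ?_⟩
  conv_lhs => rw [hs.eq_prod_roots, ← hL]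
  rw [Multiset.map_coe, Multiset.prod_coe]
  congr 1
  exact (Fin.prod_univ_fun_getElem L fun x => X - C x).symm

theorem conjReciprocal_prod_X_sub_C {n : ℕ} (a : Fin n → ℂ) :
    conjReciprocal n (∏ k, (X - C (a k))) = ∏ k, (1 - C (conj (a k)) * X) := by
  induction n with
  | zero => simp [conjReciprocal]
  | succ n ih =>
    have hlin (x : ℂ) : (X - C x).reflect 1 = 1 - C x * X := by
      rw [reflect_sub, reflect_one_X, reflect_C, pow_one]
    have hdeg : (∏ k : Fin n, (X - C (conj (a k.castSucc)))).natDegree ≤ n := by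
      rw [natDegree_finsetProd_X_sub_C_eq_card, card_univ, Fintype.card_fin]
    rw [Fin.prod_univ_castSucc, Fin.prod_univ_castSucc, ← ih, conjReciprocal, conjReciprocal]
    simp only [Polynomial.map_mul, Polynomial.map_sub, Polynomial.map_prod, map_X, map_C]
    rw [reflect_mul _ _ hdeg (natDegree_X_sub_C_le _), hlin]

theorem isBlaschkeProduct_eval_div_eval_conjReciprocal {p : ℂ[X]} {n : ℕ}
    (hn : p.natDegree = n) (hroots : ∀ z, p.eval z = 0 → ‖z‖ < 1) :
    IsBlaschkeProduct n fun z => p.eval z / (conjReciprocal n p).eval z := by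
  obtain ⟨a, ha⟩ := exists_eq_C_leadingCoeff_mul_prod hn
  set c := p.leadingCoeff
  have hc : c ≠ 0 := by
    refine leadingCoeff_ne_zero.2 ?_
    rintro rfl
    exact (hroots 1 eval_zero).ne norm_one
  have hp_eval (z : ℂ) : p.eval z = c * ∏ k, (z - a k) := by
    rw [ha]
    simp only [eval_mul, eval_C, eval_prod, eval_sub, eval_X]
  have hq_eval (z : ℂ) : (conjReciprocal n p).eval z = conj c * ∏ k, (1 - conj (a k) * z) := by
    rw [ha, conjReciprocal_C_mul, conjReciprocal_prod_X_sub_C]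
    simp only [eval_mul, eval_C, eval_prod, eval_sub, eval_one, eval_X]
  refine ⟨c / conj c, a, ?_, fun k => hroots _ ?_, fun z => ?_⟩
  · rw [norm_div, Complex.norm_conj, div_self (norm_ne_zero_iff.2 hc)]
  · rw [hp_eval, prod_eq_zero (mem_univ k) (sub_self _), mul_zero]
  · beta_reduce
    rw [hp_eval, hq_eval, prod_div_distrib, mul_div_mul_comm]

/-- The quotient `p / q` of the Lagrange polynomial `p = g_n^(l+1,l-1)` and its conjugate-reciprocal
`q = g_n^(l-1,l+1)`. For `l = ν + 1` it is the hypergeometric quotient `B(-n, ν+2; -n-ν+1; z)`, with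
the common constant factor of `p` and `q` chosen so that the recursions of `lagrangePoly` apply. -/
noncomputable def lagrangeBlaschke (l : ℝ) (n : ℕ) (z : ℂ) : ℂ :=
  (lagrangePoly ((l : ℂ) + 1) (l - 1) n).eval z / (lagrangePoly ((l : ℂ) - 1) (l + 1) n).eval z

section Hypergeometric

variable {ν : ℝ}

theorem lagrangePoly_eq_C_mul_hyperPoly_of_neg_one_lt (hν : -1 < ν) (hν0 : ν ≠ 0) (n : ℕ) :
    lagrangePoly (((ν + 1 : ℝ) : ℂ) + 1) ((ν + 1 : ℝ) - 1) n =
      C (Ring.multichoose (ν : ℂ) n) * hyperPoly n ((ν : ℂ) + 2) (-(n : ℂ) - ν + 1) := by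
  have h₁ : ((ν + 1 : ℝ) : ℂ) + 1 = ν + 2 := by push_cast; ring
  have h₂ : ((ν + 1 : ℝ) : ℂ) - 1 = ν := by push_cast; ring
  rw [h₁, h₂, lagrangePoly_eq_C_mul_hyperPoly (multichoose_ofReal_ne_zero hν hν0 n)]

theorem hyperBlaschke_eq_lagrangeBlaschke (hν : -1 < ν) (hν0 : ν ≠ 0) (n : ℕ) :
    hyperBlaschke n ((ν : ℂ) + 2) (-(n : ℂ) - ν + 1) = lagrangeBlaschke (ν + 1) n := by
  have hP := lagrangePoly_eq_C_mul_hyperPoly_of_neg_one_lt hν hν0 n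
  have hQ := congrArg (conjReciprocal n) hP
  rw [conjReciprocal_C_mul, conjReciprocal_lagrangePoly, Ring.map_multichoose] at hQ
  simp only [map_add, map_sub, map_one, Complex.conj_ofReal] at hQ
  ext z
  rw [lagrangeBlaschke, hP, hQ, eval_C_mul, eval_C_mul,
    mul_div_mul_left _ _ (multichoose_ofReal_ne_zero hν hν0 n), hyperBlaschke]

theorem isHyperBlaschke (hν : -1 < ν) (hν0 : ν ≠ 0) (n : ℕ) :
    IsHyperBlaschke n ((ν : ℂ) + 2) (-(n : ℂ) - ν + 1) := by
  have hc := multichoose_ofReal_ne_zero hν hν0 n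
  have hP := lagrangePoly_eq_C_mul_hyperPoly_of_neg_one_lt hν hν0 n
  have hzeros (z : ℂ) (hz : (hyperPoly n ((ν : ℂ) + 2) (-(n : ℂ) - ν + 1)).eval z = 0) :
      ‖z‖ < 1 := by
    refine norm_lt_one_of_eval_lagrangePoly_eq_zero (l := ν + 1) (n := n) (by linarith) ?_
    rw [hP, eval_C_mul, hz, mul_zero]
  have hlead : Ring.multichoose (((ν + 1 : ℝ) : ℂ) + 1) n ≠ 0 := by
    exact_mod_cast multichoose_ofReal_ne_zero (x := ν + 1 + 1) (by linarith) (by linarith) n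
  have hdeg : (hyperPoly n ((ν : ℂ) + 2) (-(n : ℂ) - ν + 1)).natDegree = n := by
    rw [← natDegree_C_mul hc, ← hP, natDegree_lagrangePoly hlead]
  refine ⟨fun k hk h => hc (multichoose_eq_zero_iff.2 ⟨n - 1 - k, by omega, ?_⟩), hzeros,
    isBlaschkeProduct_eval_div_eval_conjReciprocal hdeg hzeros⟩
  rw [Nat.cast_sub (by omega), Nat.cast_sub (by omega), Nat.cast_one]
  linear_combination -h

end Hypergeometric

section Derivative

variable {l : ℝ} {n : ℕ} {z : ℂ}

theorem eval_lagrangePoly_mul_eval_lagrangePoly_shift_two (l : ℝ) (n : ℕ) (hz : ‖z‖ = 1) :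
    (lagrangePoly ((l : ℂ) + 1) (l - 1) n).eval z * (lagrangePoly ((l : ℂ) - 1) (l + 1) n).eval z =
      z ^ n * (‖(lagrangePoly ((l : ℂ) + 1) (l - 1) n).eval z‖ ^ 2 : ℝ) := by
  simpa only [map_add, map_sub, map_one, Complex.conj_ofReal] using
    eval_lagrangePoly_mul_eval_lagrangePoly_conj ((l : ℂ) + 1) (l - 1) n hz

theorem norm_eval_lagrangePoly_sub_one_add_one (hl : 0 < l) (hz : ‖z‖ = 1) :
    ‖(lagrangePoly ((l : ℂ) - 1) (l + 1) n).eval z‖ =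
      ‖(lagrangePoly ((l : ℂ) + 1) (l - 1) n).eval z‖ := by
  have h := congrArg norm (eval_lagrangePoly_mul_eval_lagrangePoly_shift_two l n hz)
  rw [norm_mul, norm_mul, norm_pow, hz, one_pow, one_mul, Complex.norm_of_nonneg (sq_nonneg _),
    sq] at h
  exact mul_left_cancel₀ (norm_ne_zero_iff.2 (eval_lagrangePoly_ne_zero_of_norm_eq_one hl hz)) h

theorem eval_lagrangePoly_sub_one_add_one_ne_zero (hl : 0 < l) (hz : ‖z‖ = 1) :
    (lagrangePoly ((l : ℂ) - 1) (l + 1) n).eval z ≠ 0 := by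
  rw [← norm_ne_zero_iff, norm_eval_lagrangePoly_sub_one_add_one hl hz, norm_ne_zero_iff]
  exact eval_lagrangePoly_ne_zero_of_norm_eq_one hl hz

theorem deriv_lagrangeBlaschke (hz : (lagrangePoly ((l : ℂ) - 1) (l + 1) n).eval z ≠ 0) :
    deriv (lagrangeBlaschke l n) z =
      (wronskian (lagrangePoly ((l : ℂ) - 1) (l + 1) n)
        (lagrangePoly ((l : ℂ) + 1) (l - 1) n)).eval z /
          (lagrangePoly ((l : ℂ) - 1) (l + 1) n).eval z ^ 2 := by
  refine (deriv_fun_div (lagrangePoly ((l : ℂ) + 1) (l - 1) n).differentiableAt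
    (lagrangePoly ((l : ℂ) - 1) (l + 1) n).differentiableAt hz).trans ?_
  rw [Polynomial.deriv, Polynomial.deriv, wronskian, eval_sub, eval_mul, eval_mul]
  ring

theorem mul_deriv_lagrangeBlaschke (hl : 0 < l) (hz : ‖z‖ = 1) :
    z * deriv (lagrangeBlaschke l n) z =
      (AffineMap.lineMap (n + (l - 1)) (n / l) (‖(lagrangePoly (l : ℂ) l n).eval z‖ ^ 2 /
        ‖(lagrangePoly ((l : ℂ) + 1) (l - 1) n).eval z‖ ^ 2) : ℝ) * lagrangeBlaschke l n z := by
  have hP := eval_lagrangePoly_ne_zero_of_norm_eq_one (n := n) hl hz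
  have hQ := eval_lagrangePoly_sub_one_add_one_ne_zero (n := n) hl hz
  have hPQ := eval_lagrangePoly_mul_eval_lagrangePoly_shift_two l n hz
  have hg := eval_lagrangePoly_mul_eval_lagrangePoly_conj (l : ℂ) l n hz
  have hW := congrArg (eval z) (wronskian_lagrangePoly_shift_two (l : ℂ) n)
  simp only [Complex.conj_ofReal, ← sq] at hg
  simp only [eval_mul, eval_add, eval_sub, eval_pow, eval_natCast, eval_one, eval_C, eval_X, hg]
    at hW
  rw [deriv_lagrangeBlaschke hQ, lagrangeBlaschke]
  set p := (lagrangePoly ((l : ℂ) + 1) (l - 1) n).eval z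
  set q := (lagrangePoly ((l : ℂ) - 1) (l + 1) n).eval z
  set g := (lagrangePoly (l : ℂ) l n).eval z
  have hmean : (l * ‖p‖ ^ 2) *
      (AffineMap.lineMap (n + (l - 1)) (n / l) (‖g‖ ^ 2 / ‖p‖ ^ 2) : ℝ) =
        l * (n + l - 1) * ‖p‖ ^ 2 + (n + l) * (1 - l) * ‖g‖ ^ 2 := by
    have := norm_ne_zero_iff.2 hP
    rw [AffineMap.lineMap_apply_ring']
    field_simp
    ring
  generalize (AffineMap.lineMap (_ : ℝ) (_ : ℝ) (_ : ℝ) : ℝ) = t at hmean ⊢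
  have hmean := congrArg Complex.ofReal hmean
  have hl' : (l : ℂ) ≠ 0 := Complex.ofReal_ne_zero.2 hl.ne'
  push_cast at hmean hPQ hW
  field_simp
  refine mul_left_cancel₀ hl' ?_
  linear_combination hW - z ^ n * hmean + (l * (n + l - 1) - l * t) * hPQ

theorem norm_lagrangeBlaschke (hl : 0 < l) (hz : ‖z‖ = 1) : ‖lagrangeBlaschke l n z‖ = 1 := by
  rw [lagrangeBlaschke, norm_div, norm_eval_lagrangePoly_sub_one_add_one hl hz, div_self]
  exact norm_ne_zero_iff.2 (eval_lagrangePoly_ne_zero_of_norm_eq_one hl hz)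

theorem lineMap_sq_norm_div_mem_uIcc (hl : 0 < l) (hz : ‖z‖ = 1) (x y : ℝ) :
    AffineMap.lineMap x y (‖(lagrangePoly (l : ℂ) l n).eval z‖ ^ 2 /
      ‖(lagrangePoly ((l : ℂ) + 1) (l - 1) n).eval z‖ ^ 2) ∈ Set.uIcc x y := by
  rw [← segment_eq_uIcc, segment_eq_image_lineMap]
  refine Set.mem_image_of_mem _ ⟨by positivity, div_le_one_of_le₀ ?_ (by positivity)⟩
  gcongr
  exact norm_eval_lagrangePoly_le hl.le hz

theorem norm_deriv_lagrangeBlaschke (hl : 0 < l) (hn : 1 ≤ n) (hz : ‖z‖ = 1) :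
    ‖deriv (lagrangeBlaschke l n) z‖ =
      AffineMap.lineMap (n + (l - 1)) (n / l) (‖(lagrangePoly (l : ℂ) l n).eval z‖ ^ 2 /
        ‖(lagrangePoly ((l : ℂ) + 1) (l - 1) n).eval z‖ ^ 2) := by
  have h := congrArg norm (mul_deriv_lagrangeBlaschke (n := n) hl hz)
  rw [norm_mul, hz, one_mul, norm_mul, norm_lagrangeBlaschke hl hz, mul_one, Complex.norm_real] at h
  have hn' : (1 : ℝ) ≤ n := Nat.one_le_cast.2 hn
  have hnonneg : 0 ≤ min (n + (l - 1)) (n / l) := le_min (by linarith) (by positivity)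
  rw [h, Real.norm_of_nonneg (hnonneg.trans (lineMap_sq_norm_div_mem_uIcc hl hz _ _).1)]

theorem norm_deriv_lagrangeBlaschke_mem_uIcc (hl : 0 < l) (hn : 1 ≤ n) (hz : ‖z‖ = 1) :
    ‖deriv (lagrangeBlaschke l n) z‖ ∈ Set.uIcc (n + (l - 1)) (n / l) :=
  norm_deriv_lagrangeBlaschke hl hn hz ▸ lineMap_sq_norm_div_mem_uIcc hl hz _ _

theorem norm_deriv_lagrangeBlaschke_one (hl : 0 < l) (hn : 1 ≤ n) :
    ‖deriv (lagrangeBlaschke l n) 1‖ = n / l := by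
  have hP : (lagrangePoly ((l : ℂ) + 1) (l - 1) n).eval 1 ≠ 0 :=
    eval_lagrangePoly_ne_zero_of_norm_eq_one hl norm_one
  have hg : (lagrangePoly (l : ℂ) l n).eval 1 = (lagrangePoly ((l : ℂ) + 1) (l - 1) n).eval 1 := by
    rw [eval_one_lagrangePoly, eval_one_lagrangePoly, add_add_sub_cancel]
  rw [norm_deriv_lagrangeBlaschke hl hn norm_one, hg,
    div_self (pow_ne_zero 2 (norm_ne_zero_iff.2 hP)), AffineMap.lineMap_apply_one]

theorem mem_extremeSet_lagrangeBlaschke_iff (hl : 0 < l) :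
    z ∈ extremeSet (lagrangeBlaschke l n) ↔
      ‖z‖ = 1 ∧ (z = 1 ∨ (lagrangePoly (l : ℂ) l n).eval z = 0) := by
  rw [extremeSet, Set.mem_ofPred_eq, mem_sphere_zero_iff_norm]
  refine and_congr_right fun hz => ?_
  have h := congrArg (eval z) (C_mul_X_mul_lagrangePoly_sub (l : ℂ) n)
  simp only [eval_mul, eval_add, eval_sub, eval_natCast, eval_one, eval_C, eval_X] at h
  have hl' : (l : ℂ) ≠ 0 := Complex.ofReal_ne_zero.2 hl.ne'
  have hln : (l : ℂ) + n ≠ 0 := by exact_mod_cast (by positivity : l + n ≠ 0)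
  rw [lagrangeBlaschke, ← mul_div_assoc,
    div_eq_one_iff_eq (eval_lagrangePoly_sub_one_add_one_ne_zero hl hz), ← sub_eq_zero,
    ← mul_eq_zero_iff_left hl', h, mul_eq_zero_iff_left hln, mul_eq_zero, sub_eq_zero]

theorem one_mem_extremeSet_lagrangeBlaschke (hl : 0 < l) :
    (1 : ℂ) ∈ extremeSet (lagrangeBlaschke l n) :=
  (mem_extremeSet_lagrangeBlaschke_iff hl).2 ⟨norm_one, .inl rfl⟩

theorem norm_deriv_lagrangeBlaschke_of_mem_extremeSet (hl : 0 < l) (hn : 1 ≤ n)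
    (hz : z ∈ extremeSet (lagrangeBlaschke l n)) (hz1 : z ≠ 1) :
    ‖deriv (lagrangeBlaschke l n) z‖ = n + (l - 1) := by
  obtain ⟨hz, hg⟩ := (mem_extremeSet_lagrangeBlaschke_iff hl).1 hz
  rw [norm_deriv_lagrangeBlaschke hl hn hz, hg.resolve_left hz1, norm_zero, zero_pow two_ne_zero,
    zero_div, AffineMap.lineMap_apply_zero]

theorem exists_mem_extremeSet_norm_deriv_eq (hl : 0 < l) (hn : 1 ≤ n) {x : ℝ}
    (hx : x = n + (l - 1) ∨ x = n / l) :
    ∃ z ∈ extremeSet (lagrangeBlaschke l n), ‖deriv (lagrangeBlaschke l n) z‖ = x := by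
  rcases hx with rfl | rfl
  · obtain ⟨z, hz, hz1, hg⟩ := exists_norm_eq_one_eval_lagrangePoly_eq_zero hl hn
    have hz := (mem_extremeSet_lagrangeBlaschke_iff hl).2 ⟨hz, .inr hg⟩
    exact ⟨z, hz, norm_deriv_lagrangeBlaschke_of_mem_extremeSet hl hn hz hz1⟩
  · exact ⟨1, one_mem_extremeSet_lagrangeBlaschke hl, norm_deriv_lagrangeBlaschke_one hl hn⟩

theorem maxDeriv_lagrangeBlaschke (hl : 0 < l) (hn : 1 ≤ n) :
    maxDeriv (lagrangeBlaschke l n) = max (n + (l - 1)) (n / l) := by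
  obtain ⟨z, hz, hd⟩ := exists_mem_extremeSet_norm_deriv_eq hl hn (max_choice _ _)
  refine IsGreatest.csSup_eq ⟨⟨z, hz.1, hd⟩, ?_⟩
  rintro _ ⟨w, hw, rfl⟩
  exact (norm_deriv_lagrangeBlaschke_mem_uIcc hl hn (mem_sphere_zero_iff_norm.1 hw)).2

theorem minDeriv_lagrangeBlaschke (hl : 0 < l) (hn : 1 ≤ n) :
    minDeriv (lagrangeBlaschke l n) = min (n + (l - 1)) (n / l) := by
  obtain ⟨z, hz, hd⟩ := exists_mem_extremeSet_norm_deriv_eq hl hn (min_choice _ _)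
  refine IsLeast.csInf_eq ⟨⟨z, hz.1, hd⟩, ?_⟩
  rintro _ ⟨w, hw, rfl⟩
  exact (norm_deriv_lagrangeBlaschke_mem_uIcc hl hn (mem_sphere_zero_iff_norm.1 hw)).1

end Derivative

theorem div_le_add_iff_nonneg {a x : ℝ} (ha : 0 ≤ a) (hx : -1 < x) :
    a / (x + 1) ≤ a + x ↔ 0 ≤ x := by
  have hx' : 0 < x + 1 := by linarith
  rw [div_le_iff₀ hx', ← sub_nonneg, show (a + x) * (x + 1) - a = x * (a + x + 1) by ring,
    mul_nonneg_iff_of_pos_right (by linarith)]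

theorem theorem3 (n : ℕ) (hn : 1 ≤ n) (ν : ℝ) (hν : -1 < ν) (hν0 : ν ≠ 0)
    (B : ℂ → ℂ) (hB : B = hyperBlaschke n ((ν : ℂ) + 2) (-(n : ℂ) - (ν : ℂ) + 1)) :
    IsHyperBlaschke n ((ν : ℂ) + 2) (-(n : ℂ) - (ν : ℂ) + 1) ∧
    (0 < ν → maxDeriv B = n + ν ∧ minDeriv B = n / (ν + 1)) ∧
    (ν < 0 → maxDeriv B = n / (ν + 1) ∧ minDeriv B = n + ν) ∧
    (∃ z ∈ extremeSet B, ‖deriv B z‖ = maxDeriv B) ∧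
    (∃ z ∈ extremeSet B, ‖deriv B z‖ = minDeriv B) ∧
    (∀ z ∈ extremeSet B \ {1}, ‖deriv B z‖ = n + ν) ∧
    (1 : ℂ) ∈ extremeSet B ∧ ‖deriv B 1‖ = n / (ν + 1) := by
  have hl : 0 < ν + 1 := by linarith
  rw [hyperBlaschke_eq_lagrangeBlaschke hν hν0] at hB
  subst hB
  have hmax := maxDeriv_lagrangeBlaschke hl hn
  have hmin := minDeriv_lagrangeBlaschke hl hn
  have hattained {x : ℝ} := exists_mem_extremeSet_norm_deriv_eq (x := x) hl hn
  rw [add_sub_cancel_right] at hmax hmin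
  refine ⟨isHyperBlaschke hν hν0 n, fun hpos => ?_, fun hneg => ?_,
    hattained (maxDeriv_lagrangeBlaschke hl hn ▸ max_choice _ _),
    hattained (minDeriv_lagrangeBlaschke hl hn ▸ min_choice _ _), fun z hz => ?_,
    one_mem_extremeSet_lagrangeBlaschke hl, norm_deriv_lagrangeBlaschke_one hl hn⟩
  · have hle := (div_le_add_iff_nonneg n.cast_nonneg hν).2 hpos.le
    exact ⟨hmax.trans (max_eq_left hle), hmin.trans (min_eq_right hle)⟩
  · have hle := le_of_not_ge (mt (div_le_add_iff_nonneg n.cast_nonneg hν).1 hneg.not_ge)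
    exact ⟨hmax.trans (max_eq_right hle), hmin.trans (min_eq_left hle)⟩
  · rw [norm_deriv_lagrangeBlaschke_of_mem_extremeSet hl hn hz.1 hz.2, add_sub_cancel_right]
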